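/- Fix a vocabulary with countably infinitely many objects, object variables and numeric variables, and with countably infinitely many predicates for each arity $n\ge 0$ and each assignment of a sort (object or numeric) to the positions $1,\dots,n$. An object term is an object or an object variable; a numeric term is an integer, a numeric variable, or $s_1+s_2$, $s_1-s_2$ or $s_1\times s_2$ with $s_1,s_2$ numeric terms. A standard atom is $B(t_1,\dots,t_n)$ with $B$ a predicate of arity $n$ and each $t_i$ a term of the sort of position $i$ of $B$; a comparison atom is $(s_1<s_2)$ or $(s_1\le s_2)$ with $s_1,s_2$ numeric terms. A rule is $\bigwedge_i\alpha_i\wedge\bigwedge_j\beta_j\to\alpha$ with finitely many standard atoms $\alpha_i$, finitely many comparison atoms $\beta_j$ and a standard atom $\alpha$ (the body may be empty), such that each variable of the rule occurs in some $\alpha_i$. A program of Datalog with integer arithmetic is a finite set of rules. A fact is a standard atom whose arguments are all objects or integers. An interpretation is a (possibly infinite) set $I$ of facts; it is a model of a program $\mathcal P$ if, for every rule of $\mathcal P$ and every substitution of objects for its object variables and integers for its numeric variables, the following holds: if the evaluated standard body atoms belong to $I$ and the evaluated comparison atoms are true over $\mathbb Z$, then the evaluated head belongs to $I$. We write $\mathcal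 P\models\alpha$ if the fact $\alpha$ belongs to every model of $\mathcal P$. Theorem. Given a program $\mathcal P$ and a fact $\alpha$ as input, checking $\mathcal P\models\alpha$ is undecidable, even if $\mathcal P$ contains no $\times$ or $-$ and each standard atom in $\mathcal P$ has at most one numeric term among its arguments. That is, no algorithm decides $\mathcal P\models\alpha$ correctly for all facts $\alpha$ and all programs $\mathcal P$ of this restricted form. -/

import Mathlib

namespace DatalogZ

/-! ## Syntax

The vocabulary is the standard countably infinite one: objects, object variables and numeric
variables are each named by natural numbers, and there are infinitely many predicates for every
arity and every assignment of sorts to the argument positions. -/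

/-- The two sorts of argument positions. -/
inductive Srt : Type
  | object
  | numeric

/-- A predicate: a name together with the list of the sorts of its positions; the arity is the
length of that list. -/
structure Predicate : Type where
  name : ℕ
  sorts : List Srt

/-- Variables of either sort. -/
inductive Var : Type
  | objVar (x : ℕ)
  | numVar (x : ℕ)

/-- Object terms: objects and object variables. -/
inductive ObjTerm : Type
  | obj (a : ℕ)
  | var (x : ℕ)

/-- Numeric terms: integers, numeric variables, sums, differences and products. -/
inductive NumTerm : Type
  | int (k : ℤ)
  | var (x : ℕ)
  | add (s t : NumTerm)
  | sub (s t : NumTerm)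
  | mul (s t : NumTerm)

/-- Terms of either sort. -/
inductive Term : Type
  | object (t : ObjTerm)
  | numeric (s : NumTerm)

/-- Constants: objects and integers. -/
inductive Constant : Type
  | object (a : ℕ)
  | int (k : ℤ)

/-- Standard atoms `B(t₁, …, tₙ)`; see `StdAtom.WellSorted` for the sort condition. -/
structure StdAtom : Type where
  pred : Predicate
  args : List Term

/-- Comparison atoms `(s₁ < s₂)` and `(s₁ ≤ s₂)`. -/
inductive CompAtom : Type
  | lt (s₁ s₂ : NumTerm)
  | le (s₁ s₂ : NumTerm)

/-- Rules: standard body, comparison body, head; see `Rule.WellFormed`. -/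
structure Rule : Type where
  sbody : List StdAtom
  cbody : List CompAtom
  head : StdAtom

/-- Facts: standard atoms all of whose arguments are constants; see `Fact.WellSorted`. -/
structure Fact : Type where
  pred : Predicate
  args : List Constant

/-- A program is given by a finite list of its rules; order and repetition play no role in the
semantics. See `Program.WellFormed`. -/
abbrev Program : Type := List Rule

/-! ### Well-formedness -/

def Term.sort : Term → Srt
  | .object _ => .object
  | .numeric _ => .numeric

def Constant.sort : Constant → Srt
  | .object _ => .object
  | .int _ => .numeric

/-- The number of arguments is the arity, and each argument has the sort of its position. -/
def StdAtom.WellSorted (A : StdAtom) : Prop := A.args.map Term.sort = A.pred.sorts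

def Fact.WellSorted (f : Fact) : Prop := f.args.map Constant.sort = f.pred.sorts

def ObjTerm.vars : ObjTerm → Set Var
  | .obj _ => ∅
  | .var x => {.objVar x}

def NumTerm.vars : NumTerm → Set Var
  | .int _ => ∅
  | .var x => {.numVar x}
  | .add s t => s.vars ∪ t.vars
  | .sub s t => s.vars ∪ t.vars
  | .mul s t => s.vars ∪ t.vars

def Term.vars : Term → Set Var
  | .object t => t.vars
  | .numeric s => s.vars

def StdAtom.vars (A : StdAtom) : Set Var := {v | ∃ t ∈ A.args, v ∈ t.vars}

def CompAtom.vars : CompAtom → Set Var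
  | .lt s t => s.vars ∪ t.vars
  | .le s t => s.vars ∪ t.vars

/-- The standard atoms occurring in a rule. -/
def Rule.stdAtoms (r : Rule) : List StdAtom := r.head :: r.sbody

/-- The variables occurring in a rule. -/
def Rule.vars (r : Rule) : Set Var :=
  {v | (∃ A ∈ r.stdAtoms, v ∈ A.vars) ∨ ∃ C ∈ r.cbody, v ∈ C.vars}

/-- Standard atoms respect sorts, and each variable of the rule occurs in some standard body
atom. -/
def Rule.WellFormed (r : Rule) : Prop :=
  (∀ A ∈ r.stdAtoms, A.WellSorted) ∧ ∀ v ∈ r.vars, ∃ A ∈ r.sbody, v ∈ A.vars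

def Program.WellFormed (P : Program) : Prop := ∀ r ∈ P, r.WellFormed

/-! ### The syntactic restrictions -/

/-- The term contains neither `-` nor `×`. -/
def NumTerm.NoSubMul : NumTerm → Prop
  | .int _ => True
  | .var _ => True
  | .add s t => s.NoSubMul ∧ t.NoSubMul
  | .sub _ _ => False
  | .mul _ _ => False

def StdAtom.NoSubMul (A : StdAtom) : Prop := ∀ s : NumTerm, Term.numeric s ∈ A.args → s.NoSubMul

def CompAtom.NoSubMul : CompAtom → Prop
  | .lt s t => s.NoSubMul ∧ t.NoSubMul
  | .le s t => s.NoSubMul ∧ t.NoSubMul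

/-- The program contains neither `-` nor `×`. -/
def Program.NoSubMul (P : Program) : Prop :=
  ∀ r ∈ P, (∀ A ∈ r.stdAtoms, A.NoSubMul) ∧ ∀ C ∈ r.cbody, C.NoSubMul

def Term.isNumeric : Term → Bool
  | .object _ => false
  | .numeric _ => true

/-- Each standard atom of the program has at most one numeric term among its arguments. -/
def Program.AtMostOneNumericTerm (P : Program) : Prop :=
  ∀ r ∈ P, ∀ A ∈ r.stdAtoms, A.args.countP Term.isNumeric ≤ 1

/-! ## Semantics -/

/-- Assignments of objects to object variables and of integers to numeric variables. -/
structure Assignment : Type where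
  obj : ℕ → ℕ
  num : ℕ → ℤ

def ObjTerm.eval (σ : Assignment) : ObjTerm → ℕ
  | .obj a => a
  | .var x => σ.obj x

def NumTerm.eval (σ : Assignment) : NumTerm → ℤ
  | .int k => k
  | .var x => σ.num x
  | .add s t => s.eval σ + t.eval σ
  | .sub s t => s.eval σ - t.eval σ
  | .mul s t => s.eval σ * t.eval σ

def Term.eval (σ : Assignment) : Term → Constant
  | .object t => .object (t.eval σ)
  | .numeric s => .int (s.eval σ)

/-- The fact obtained from a standard atom by substituting its variables according to `σ` and
evaluating the arithmetic functions. -/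
def StdAtom.eval (σ : Assignment) (A : StdAtom) : Fact := ⟨A.pred, A.args.map (Term.eval σ)⟩

def CompAtom.Holds (σ : Assignment) : CompAtom → Prop
  | .lt s t => s.eval σ < t.eval σ
  | .le s t => s.eval σ ≤ t.eval σ

/-- A (Herbrand) interpretation: a possibly infinite set of (well-sorted) facts. -/
structure Interpretation : Type where
  facts : Set Fact
  wellSorted : ∀ f ∈ facts, f.WellSorted

/-- `I` satisfies the universally quantified rule `r`. -/
def Interpretation.SatisfiesRule (I : Interpretation) (r : Rule) : Prop :=
  ∀ σ : Assignment,
    (∀ A ∈ r.sbody, A.eval σ ∈ I.facts) → (∀ C ∈ r.cbody, C.Holds σ) → r.head.eval σ ∈ I.facts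

/-- `I` is a model of `P`. -/
def Interpretation.IsModel (I : Interpretation) (P : Program) : Prop :=
  ∀ r ∈ P, I.SatisfiesRule r

/-- `P` entails the fact `α`. -/
def Program.Entails (P : Program) (α : Fact) : Prop :=
  ∀ I : Interpretation, I.IsModel P → α ∈ I.facts

/-! ## Effective coding of programs and facts

Explicit Gödel numberings, so that programs and facts can be inputs of algorithms. -/

/-- Gödel numbering of numeric terms. -/
def NumTerm.toNat : NumTerm → ℕ
  | .int k => 5 * Encodable.encode k
  | .var x => 5 * x + 1
  | .add s t => 5 * Nat.pair s.toNat t.toNat + 2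
  | .sub s t => 5 * Nat.pair s.toNat t.toNat + 3
  | .mul s t => 5 * Nat.pair s.toNat t.toNat + 4

/-- The inverse of `NumTerm.toNat`. -/
def NumTerm.ofNat (n : ℕ) : NumTerm :=
  if _h₀ : n % 5 = 0 then .int (Denumerable.ofNat ℤ (n / 5))
  else if _h₁ : n % 5 = 1 then .var (n / 5)
  else
    have _hl : (n / 5).unpair.1 < n := lt_of_le_of_lt (Nat.unpair_left_le _) (by omega)
    have _hr : (n / 5).unpair.2 < n := lt_of_le_of_lt (Nat.unpair_right_le _) (by omega)
    if n % 5 = 2 then .add (NumTerm.ofNat (n / 5).unpair.1) (NumTerm.ofNat (n / 5).unpair.2)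
    else if n % 5 = 3 then .sub (NumTerm.ofNat (n / 5).unpair.1) (NumTerm.ofNat (n / 5).unpair.2)
    else .mul (NumTerm.ofNat (n / 5).unpair.1) (NumTerm.ofNat (n / 5).unpair.2)
termination_by n

theorem NumTerm.ofNat_toNat (s : NumTerm) : NumTerm.ofNat s.toNat = s := by
  induction s with
  | int k =>
    rw [NumTerm.ofNat, NumTerm.toNat, dif_pos (by omega), Nat.mul_div_cancel_left _ (by norm_num),
      Denumerable.ofNat_encode]
  | var x =>
    rw [NumTerm.ofNat, NumTerm.toNat, dif_neg (by omega), dif_pos (by omega),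
      show (5 * x + 1) / 5 = x by omega]
  | add s t hs ht =>
    rw [NumTerm.ofNat, NumTerm.toNat, dif_neg (by omega), dif_neg (by omega)]
    simp only [show ∀ m, (5 * m + 2) / 5 = m by omega, show ∀ m, (5 * m + 2) % 5 = 2 by omega,
      Nat.unpair_pair, hs, ht, if_true]
  | sub s t hs ht =>
    rw [NumTerm.ofNat, NumTerm.toNat, dif_neg (by omega), dif_neg (by omega)]
    simp [show ∀ m, (5 * m + 3) / 5 = m by omega, show ∀ m, (5 * m + 3) % 5 = 3 by omega, hs, ht]
  | mul s t hs ht =>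
    rw [NumTerm.ofNat, NumTerm.toNat, dif_neg (by omega), dif_neg (by omega)]
    simp [show ∀ m, (5 * m + 4) / 5 = m by omega, show ∀ m, (5 * m + 4) % 5 = 4 by omega, hs, ht]

theorem NumTerm.toNat_ofNat (n : ℕ) : (NumTerm.ofNat n).toNat = n := by
  induction n using Nat.strong_induction_on with
  | _ n ih =>
    rw [NumTerm.ofNat]
    split_ifs with h₀ h₁ h₂ h₃
    · simp only [NumTerm.toNat, Denumerable.encode_ofNat]; omega
    · simp only [NumTerm.toNat]; omega
    all_goals
      have hl : (n / 5).unpair.1 < n := lt_of_le_of_lt (Nat.unpair_left_le _) (by omega)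
      have hr : (n / 5).unpair.2 < n := lt_of_le_of_lt (Nat.unpair_right_le _) (by omega)
      simp only [NumTerm.toNat, ih _ hl, ih _ hr, Nat.pair_unpair]
      omega

def NumTerm.equivNat : NumTerm ≃ ℕ where
  toFun := NumTerm.toNat
  invFun := NumTerm.ofNat
  left_inv := NumTerm.ofNat_toNat
  right_inv := NumTerm.toNat_ofNat

def Srt.equivBool : Srt ≃ Bool where
  toFun | .object => false | .numeric => true
  invFun | false => .object | true => .numeric
  left_inv s := by cases s <;> rfl
  right_inv b := by cases b <;> rfl

def Predicate.equivProd : Predicate ≃ ℕ × List Srt where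
  toFun p := (p.name, p.sorts)
  invFun p := ⟨p.1, p.2⟩
  left_inv _ := rfl
  right_inv _ := rfl

def ObjTerm.equivSum : ObjTerm ≃ ℕ ⊕ ℕ where
  toFun | .obj a => .inl a | .var x => .inr x
  invFun | .inl a => .obj a | .inr x => .var x
  left_inv t := by cases t <;> rfl
  right_inv t := by cases t <;> rfl

def Term.equivSum : Term ≃ ObjTerm ⊕ NumTerm where
  toFun | .object t => .inl t | .numeric s => .inr s
  invFun | .inl t => .object t | .inr s => .numeric s
  left_inv t := by cases t <;> rfl
  right_inv t := by cases t <;> rfl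

def Constant.equivSum : Constant ≃ ℕ ⊕ ℤ where
  toFun | .object a => .inl a | .int k => .inr k
  invFun | .inl a => .object a | .inr k => .int k
  left_inv c := by cases c <;> rfl
  right_inv c := by cases c <;> rfl

def StdAtom.equivProd : StdAtom ≃ Predicate × List Term where
  toFun A := (A.pred, A.args)
  invFun p := ⟨p.1, p.2⟩
  left_inv _ := rfl
  right_inv _ := rfl

def CompAtom.equivSum : CompAtom ≃ (NumTerm × NumTerm) ⊕ (NumTerm × NumTerm) where
  toFun | .lt s t => .inl (s, t) | .le s t => .inr (s, t)
  invFun | .inl p => .lt p.1 p.2 | .inr p => .le p.1 p.2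
  left_inv C := by cases C <;> rfl
  right_inv C := by cases C <;> rfl

def Rule.equivProd : Rule ≃ List StdAtom × List CompAtom × StdAtom where
  toFun r := (r.sbody, r.cbody, r.head)
  invFun p := ⟨p.1, p.2.1, p.2.2⟩
  left_inv _ := rfl
  right_inv _ := rfl

def Fact.equivProd : Fact ≃ Predicate × List Constant where
  toFun f := (f.pred, f.args)
  invFun p := ⟨p.1, p.2⟩
  left_inv _ := rfl
  right_inv _ := rfl

instance : Primcodable NumTerm := Primcodable.ofEquiv ℕ NumTerm.equivNat
instance : Primcodable Srt := Primcodable.ofEquiv Bool Srt.equivBool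
instance : Primcodable Predicate := Primcodable.ofEquiv (ℕ × List Srt) Predicate.equivProd
instance : Primcodable ObjTerm := Primcodable.ofEquiv (ℕ ⊕ ℕ) ObjTerm.equivSum
instance : Primcodable Term := Primcodable.ofEquiv (ObjTerm ⊕ NumTerm) Term.equivSum
instance : Primcodable Constant := Primcodable.ofEquiv (ℕ ⊕ ℤ) Constant.equivSum
instance : Primcodable StdAtom := Primcodable.ofEquiv (Predicate × List Term) StdAtom.equivProd
instance : Primcodable CompAtom :=
  Primcodable.ofEquiv ((NumTerm × NumTerm) ⊕ (NumTerm × NumTerm)) CompAtom.equivSum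
instance : Primcodable Rule :=
  Primcodable.ofEquiv (List StdAtom × List CompAtom × StdAtom) Rule.equivProd
instance : Primcodable Fact := Primcodable.ofEquiv (Predicate × List Constant) Fact.equivProd

end DatalogZ

/-!
A partial recursive function is computed by a finite system of Horn rules over binary relations on
`ℕ`, one relation `{(a, b) | b ∈ c.eval a}` for each subcode `c`; the rules only use addition, since
the pairing function can be generated from `Nat.pair a b` to `Nat.pair a b + 1`.

A binary relation is made unary by storing `(a, b)` as the single number `2 ^ (a + b) + a`. An atom
`R(s, t)` becomes `R(p + s)` with a fresh variable `p`, and `p = 2 ^ (s + t)` is enforced without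
multiplication: `2 ^ k + a` with `a < 2 ^ k` determines `k` and `a`, so it suffices to require that
`p` is a power of two, that `s + t < p`, and that `p + (s + t)` is of the form `2 ^ k + k`. The sets
`{2 ^ k}` and `{2 ^ k + k}` are in turn generated by rules with unary atoms.
-/

namespace DatalogZ

open Encodable (encode decode)
open Nat.Partrec (Code)

/-! ### Storing a pair of natural numbers in a power of two -/

/-- The pairing function by which binary relations on `ℕ` are represented as sets of integers. -/
def powPair (a b : ℕ) : ℕ := 2 ^ (a + b) + a

theorem log_two_pow_add {k a : ℕ} (h : a < 2 ^ k) : Nat.log 2 (2 ^ k + a) = k :=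
  Nat.log_eq_of_pow_le_of_lt_pow (Nat.le_add_right _ _) (by rw [pow_succ]; lia)

theorem two_pow_add_inj {k l a b : ℕ} (ha : a < 2 ^ k) (hb : b < 2 ^ l)
    (h : 2 ^ k + a = 2 ^ l + b) : k = l ∧ a = b := by
  obtain rfl : k = l := by rw [← log_two_pow_add ha, h, log_two_pow_add hb]
  exact ⟨rfl, Nat.add_left_cancel h⟩

theorem powPair_inj {a b c d : ℕ} (h : powPair a b = powPair c d) : a = c ∧ b = d := by
  have lt_two_pow_add (a b : ℕ) : a < 2 ^ (a + b) := (Nat.le_add_right a b).trans_lt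
    Nat.lt_two_pow_self
  obtain ⟨hsum, hfst⟩ := two_pow_add_inj (lt_two_pow_add a b) (lt_two_pow_add c d) h
  lia

theorem primrec₂_powPair : Primrec₂ powPair :=
  have pow : Primrec₂ fun a b : ℕ => a ^ b := Primrec₂.unpaired'.1 Nat.Primrec.pow
  Primrec.nat_add.comp (pow.comp (.const 2) (Primrec.nat_add.comp .fst .snd)) .fst

/-! ### Horn rules over binary relations on the natural numbers -/

/-- Terms over `ℕ` built by addition; the arguments of the atoms of `RelRule`. -/
inductive NatTerm : Type
  | const (k : ℕ)
  | var (x : ℕ)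
  | add (s t : NatTerm)

namespace NatTerm

instance : Zero NatTerm := ⟨.const 0⟩
instance : One NatTerm := ⟨.const 1⟩
instance : Add NatTerm := ⟨.add⟩

/-- The value of a term under the valuation `v` of the variables. -/
def eval (v : ℕ → ℕ) : NatTerm → ℕ
  | .const k => k
  | .var x => v x
  | .add s t => s.eval v + t.eval v

/-- The variables of a term. A list, as `guards` turns them into body atoms. -/
def vars : NatTerm → List ℕ
  | .const _ => []
  | .var x => [x]
  | .add s t => s.vars ++ t.vars

variable (v : ℕ → ℕ)

@[simp] theorem eval_zero : (0 : NatTerm).eval v = 0 := rfl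

@[simp] theorem eval_one : (1 : NatTerm).eval v = 1 := rfl

@[simp] theorem eval_var (x : ℕ) : (var x).eval v = v x := rfl

@[simp] theorem eval_add (s t : NatTerm) : (s + t).eval v = s.eval v + t.eval v := rfl

/-- The numeric term obtained by renaming the variables according to `ρ`. -/
def toNum (ρ : ℕ → ℕ) : NatTerm → NumTerm
  | .const k => .int k
  | .var x => .var (ρ x)
  | .add s t => .add (s.toNum ρ) (t.toNum ρ)

theorem noSubMul_toNum (ρ : ℕ → ℕ) (t : NatTerm) : (t.toNum ρ).NoSubMul := by
  induction t with
  | const | var => trivial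
  | add s t hs ht => exact ⟨hs, ht⟩

variable {v} in
theorem eval_toNum {t : NatTerm} {ρ : ℕ → ℕ} {σ : Assignment}
    (h : ∀ x ∈ t.vars, σ.num (ρ x) = v x) : (t.toNum ρ).eval σ = t.eval v := by
  induction t with
  | const k => rfl
  | var x => exact h x (List.mem_singleton_self x)
  | add s t hs ht =>
    rw [vars, List.forall_mem_append] at h
    simp only [toNum, NumTerm.eval, eval, hs h.1, ht h.2, Nat.cast_add]

/-- A left inverse of `toNum id`, with the junk value `0` on differences and products. -/
def ofNum : NumTerm → NatTerm
  | .int k => .const k.toNat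
  | .var x => .var x
  | .add s t => .add (ofNum s) (ofNum t)
  | .sub _ _ | .mul _ _ => 0

theorem ofNum_toNum (t : NatTerm) : ofNum (t.toNum id) = t := by
  induction t with
  | const | var => rfl
  | add s t hs ht => rw [toNum, ofNum, hs, ht]

instance : Encodable NatTerm := .ofLeftInverse (toNum id) ofNum ofNum_toNum

end NatTerm

/-- Atoms over binary relations on `ℕ` whose relation symbols are the elements of `κ`. -/
structure RelAtom (κ : Type*) where
  symbol : κ
  fst : NatTerm
  snd : NatTerm

/-- Horn rules over binary relations on `ℕ`, the source language of the translation into Datalog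
with integer arithmetic. -/
structure RelRule (κ : Type*) where
  body : List (RelAtom κ)
  head : RelAtom κ

/-- Finite systems of Horn rules over binary relations on `ℕ`. -/
abbrev RelProgram (κ : Type*) := List (RelRule κ)

section RelSemantics

variable {κ : Type*}

/-- Truth of an atom when the symbols are interpreted by `G` and the variables by `v`. -/
def RelAtom.Holds (G : κ → ℕ → ℕ → Prop) (v : ℕ → ℕ) (A : RelAtom κ) : Prop :=
  G A.symbol (A.fst.eval v) (A.snd.eval v)

/-- Truth of a universally quantified rule when the symbols are interpreted by `G`. -/
def RelRule.Valid (G : κ → ℕ → ℕ → Prop) (r : RelRule κ) : Prop :=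
  ∀ v, (∀ A ∈ r.body, A.Holds G v) → r.head.Holds G v

variable {G : κ → ℕ → ℕ → Prop}

theorem holds_mk {v : ℕ → ℕ} {s : κ} {t u : NatTerm} :
    RelAtom.Holds G v ⟨s, t, u⟩ ↔ G s (t.eval v) (u.eval v) := Iff.rfl

theorem valid_mk_iff {body : List (RelAtom κ)} {head : RelAtom κ} :
    RelRule.Valid G ⟨body, head⟩ ↔ ∀ v, (∀ A ∈ body, A.Holds G v) → head.Holds G v := Iff.rfl

/-- The pair `(a, b)` belongs to the relation `s` in every model of `R`. -/
def RelProgram.Entails (R : RelProgram κ) (s : κ) (a b : ℕ) : Prop :=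
  ∀ G : κ → ℕ → ℕ → Prop, (∀ r ∈ R, r.Valid G) → G s a b

end RelSemantics

/-! ### Monadic additive programs -/

/-- The atom `X(t)` of the unary numeric predicate named `X`. -/
def unaryAtom (X : ℕ) (t : NumTerm) : StdAtom := ⟨⟨X, [.numeric]⟩, [.numeric t]⟩

/-- The fact `X(z)` of the unary numeric predicate named `X`. -/
def unaryFact (X : ℕ) (z : ℤ) : Fact := ⟨⟨X, [.numeric]⟩, [.int z]⟩

theorem wellSorted_unaryFact (X : ℕ) (z : ℤ) : (unaryFact X z).WellSorted := rfl

theorem unaryFact_inj {X Y : ℕ} {z w : ℤ} : unaryFact X z = unaryFact Y w ↔ X = Y ∧ z = w := by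
  simp [unaryFact]

theorem primrec_unaryFact (X : ℕ) : Primrec (unaryFact X) :=
  have int : Primrec Constant.int := (Primrec.of_equiv_symm (e := Constant.equivSum)).comp .sumInr
  have mk : Primrec fun p : Predicate × List Constant => Fact.mk p.1 p.2 :=
    Primrec.of_equiv_symm (e := Fact.equivProd)
  mk.comp ((Primrec.const _).pair (Primrec.list_cons.comp int (.const [])))

theorem mem_vars_unaryAtom {X : ℕ} {t : NumTerm} {x : Var} :
    x ∈ (unaryAtom X t).vars ↔ x ∈ t.vars := by
  simp [StdAtom.vars, unaryAtom, Term.vars]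

/-- The set of integers which an interpretation assigns to the unary numeric predicate `X`. -/
def Interpretation.ext (I : Interpretation) (X : ℕ) : Set ℤ := {z | unaryFact X z ∈ I.facts}

theorem eval_unaryAtom_mem {I : Interpretation} {σ : Assignment} {X : ℕ} {t : NumTerm} :
    (unaryAtom X t).eval σ ∈ I.facts ↔ t.eval σ ∈ I.ext X := Iff.rfl

/-- Standard atoms `X(t)` where `X` is a unary numeric predicate and `t` contains no `-` or `×`. -/
def StdAtom.IsMonadicAdditive (A : StdAtom) : Prop := ∃ X t, t.NoSubMul ∧ A = unaryAtom X t

theorem isMonadicAdditive_unaryAtom {X : ℕ} {t : NumTerm} (h : t.NoSubMul) :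
    (unaryAtom X t).IsMonadicAdditive := ⟨X, t, h, rfl⟩

/-- Safe rules without `-` and `×` all of whose predicates are unary and numeric. -/
structure Rule.IsMonadicAdditive (r : Rule) : Prop where
  unary : ∀ A ∈ r.stdAtoms, A.IsMonadicAdditive
  noSubMul : ∀ C ∈ r.cbody, C.NoSubMul
  safe : ∀ x ∈ r.vars, ∃ A ∈ r.sbody, x ∈ A.vars

/-- Programs consisting of monadic additive rules; they satisfy all syntactic restrictions. -/
def Program.IsMonadicAdditive (P : Program) : Prop := ∀ r ∈ P, r.IsMonadicAdditive

namespace Program.IsMonadicAdditive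

variable {P : Program}

theorem wellFormed (h : P.IsMonadicAdditive) : P.WellFormed := by
  refine fun r hr => ⟨fun A hA => ?_, (h r hr).safe⟩
  obtain ⟨X, t, -, rfl⟩ := (h r hr).unary A hA
  rfl

theorem noSubMul (h : P.IsMonadicAdditive) : P.NoSubMul := by
  refine fun r hr => ⟨fun A hA s hs => ?_, (h r hr).noSubMul⟩
  obtain ⟨X, t, ht, rfl⟩ := (h r hr).unary A hA
  obtain rfl : s = t := by simpa [unaryAtom] using hs
  exact ht

theorem atMostOneNumericTerm (h : P.IsMonadicAdditive) : P.AtMostOneNumericTerm := by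
  intro r hr A hA
  obtain ⟨X, t, -, rfl⟩ := (h r hr).unary A hA
  exact List.countP_le_length

end Program.IsMonadicAdditive

/-! ### Auxiliary predicates -/

/-- The auxiliary predicates for the natural numbers, the powers of two and the numbers
`2 ^ k + k`. -/
inductive AuxPred : Type
  | nat
  | pow
  | exp

namespace AuxPred

/-- The name of the unary numeric predicate standing for an auxiliary predicate. -/
def name : AuxPred → ℕ
  | nat => 0
  | pow => 1
  | exp => 2

theorem name_injective : Function.Injective name := by
  rintro (_ | _ | _) (_ | _ | _) h <;> trivial

/-- The intended extension of an auxiliary predicate. -/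
def stdExt : AuxPred → Set ℤ
  | nat => Set.range fun n : ℕ => (n : ℤ)
  | pow => Set.range fun k : ℕ => (2 ^ k : ℤ)
  | exp => Set.range fun k : ℕ => (2 ^ k + k : ℤ)

/-- The atom stating that `t` belongs to the auxiliary predicate `X`. -/
def atom (X : AuxPred) (t : NumTerm) : StdAtom := unaryAtom X.name t

theorem eval_atom_mem {I : Interpretation} {σ : Assignment} {X : AuxPred} {t : NumTerm} :
    (X.atom t).eval σ ∈ I.facts ↔ t.eval σ ∈ I.ext X.name := Iff.rfl

theorem eq_two_pow_of_mem {p : ℤ} {n : ℕ} (hp : p ∈ pow.stdExt) (hexp : p + n ∈ exp.stdExt)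
    (hlt : n < p) : p = 2 ^ n := by
  obtain ⟨k, rfl⟩ := hp
  obtain ⟨l, hl⟩ := hexp
  dsimp only at hl hlt ⊢
  norm_cast at hl hlt ⊢
  obtain ⟨rfl, rfl⟩ := two_pow_add_inj Nat.lt_two_pow_self hlt hl
  rfl

/-- Rules generating the extensions of the auxiliary predicates. The body of the last rule forces
its first variable to be `2 ^ n`, where `n` is the second one. -/
def rules : Program :=
  [⟨[], [], nat.atom (.int 0)⟩,
    ⟨[nat.atom (.var 0)], [], nat.atom (.add (.var 0) (.int 1))⟩,
    ⟨[], [], pow.atom (.int 1)⟩,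
    ⟨[pow.atom (.var 0)], [], pow.atom (.add (.var 0) (.var 0))⟩,
    ⟨[], [], exp.atom (.int 1)⟩,
    ⟨[pow.atom (.var 0), nat.atom (.var 1), exp.atom (.add (.var 0) (.var 1))],
      [.lt (.var 1) (.var 0)],
      exp.atom (.add (.add (.var 0) (.var 0)) (.add (.var 1) (.int 1)))⟩]

theorem isMonadicAdditive_rules : rules.IsMonadicAdditive := by
  intro r hr
  simp only [rules, List.mem_cons, List.not_mem_nil, or_false] at hr
  rcases hr with rfl | rfl | rfl | rfl | rfl | rfl <;> constructor <;>
    simp [StdAtom.IsMonadicAdditive, Rule.stdAtoms, Rule.vars, atom, unaryAtom, StdAtom.vars,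
      CompAtom.vars, Term.vars, NumTerm.vars, NumTerm.NoSubMul, CompAtom.NoSubMul]
  tauto

theorem isModel_rules_iff {I : Interpretation} : I.IsModel rules ↔
    0 ∈ I.ext nat.name ∧ (∀ x ∈ I.ext nat.name, x + 1 ∈ I.ext nat.name) ∧
    1 ∈ I.ext pow.name ∧ (∀ x ∈ I.ext pow.name, x + x ∈ I.ext pow.name) ∧
    1 ∈ I.ext exp.name ∧ ∀ p x, p ∈ I.ext pow.name → x ∈ I.ext nat.name →
      p + x ∈ I.ext exp.name → x < p → p + p + (x + 1) ∈ I.ext exp.name := by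
  have : Nonempty Assignment := ⟨⟨0, 0⟩⟩
  simp only [Interpretation.IsModel, rules, List.forall_mem_cons, List.not_mem_nil,
    Interpretation.SatisfiesRule, eval_atom_mem, NumTerm.eval, CompAtom.Holds, false_implies,
    implies_true, and_true, and_imp, forall_const]
  exact and_congr_right' <| and_congr ⟨fun h x => h ⟨0, fun _ => x⟩, fun h σ => h _⟩ <|
    and_congr_right' <| and_congr ⟨fun h x => h ⟨0, fun _ => x⟩, fun h σ => h _⟩ <|
    and_congr_right' ⟨fun h p x => h ⟨0, fun | 0 => p | _ => x⟩, fun h σ => h _ _⟩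

end AuxPred

/-- The auxiliary predicates contain at most what they are meant to contain. -/
def Interpretation.AuxSound (I : Interpretation) : Prop :=
  ∀ X : AuxPred, I.ext X.name ⊆ X.stdExt

/-- The auxiliary predicates contain at least what they are meant to contain. -/
def Interpretation.AuxComplete (I : Interpretation) : Prop :=
  ∀ X : AuxPred, X.stdExt ⊆ I.ext X.name

namespace AuxPred

theorem auxComplete_of_isModel {I : Interpretation} (h : I.IsModel rules) : I.AuxComplete := by
  obtain ⟨nat_zero, nat_succ, pow_zero, pow_succ, exp_zero, exp_succ⟩ := isModel_rules_iff.1 h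
  have nat_mem (n : ℕ) : (n : ℤ) ∈ I.ext nat.name := by
    induction n with
    | zero => exact nat_zero
    | succ n ih => exact_mod_cast nat_succ n ih
  have pow_mem (k : ℕ) : (2 ^ k : ℤ) ∈ I.ext pow.name := by
    induction k with
    | zero => exact pow_zero
    | succ k ih => simpa only [_root_.pow_succ, mul_two] using pow_succ _ ih
  have exp_mem (k : ℕ) : (2 ^ k + k : ℤ) ∈ I.ext exp.name := by
    induction k with
    | zero => exact exp_zero
    | succ k ih =>
      have hlt : (k : ℤ) < 2 ^ k := mod_cast Nat.lt_two_pow_self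
      simpa only [_root_.pow_succ, mul_two, Nat.cast_succ] using
        exp_succ _ _ (pow_mem k) (nat_mem k) ih hlt
  rintro (_ | _ | _) _ ⟨k, rfl⟩
  exacts [nat_mem k, pow_mem k, exp_mem k]

theorem isModel_rules {I : Interpretation} (hs : I.AuxSound) (hc : I.AuxComplete) :
    I.IsModel rules := by
  refine isModel_rules_iff.2 ⟨hc nat ⟨0, rfl⟩, fun x hx => ?_, hc pow ⟨0, rfl⟩, fun p hp => ?_,
    hc exp ⟨0, rfl⟩, fun p x hp hx hpx hlt => ?_⟩
  · obtain ⟨n, rfl⟩ := hs nat hx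
    exact hc nat ⟨n + 1, Nat.cast_succ n⟩
  · obtain ⟨k, rfl⟩ := hs pow hp
    exact hc pow ⟨k + 1, by ring⟩
  · obtain ⟨n, rfl⟩ := hs nat hx
    obtain rfl : p = 2 ^ n := eq_two_pow_of_mem (hs pow hp) (hs exp hpx) hlt
    exact hc exp ⟨n + 1, by push_cast; ring⟩

end AuxPred

/-! ### Translating rules over binary relations -/

/-- The number of the numeric variable representing the variable `x` of a `NatTerm`. -/
def natVar (x : ℕ) : ℕ := encode (Sum.inl x : ℕ ⊕ NatTerm)

/-- The number of the numeric variable standing for `2 ^ t`. -/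
def powVar (t : NatTerm) : ℕ := encode (Sum.inr t : ℕ ⊕ NatTerm)

namespace NatTerm

/-- Body atoms which, together with `bound`, state that the variable `powVar t` has the value
`2 ^ t` and that the variables of `t` are natural numbers. -/
def guards (t : NatTerm) : List StdAtom :=
  [AuxPred.pow.atom (.var (powVar t)),
    AuxPred.exp.atom (.add (.var (powVar t)) (t.toNum natVar))] ++
    t.vars.map fun x => AuxPred.nat.atom (.var (natVar x))

/-- The comparison which makes `guards` pin down the value of `powVar t`. -/
def bound (t : NatTerm) : CompAtom := .lt (t.toNum natVar) (.var (powVar t))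

theorem isMonadicAdditive_guards (t : NatTerm) : ∀ A ∈ t.guards, A.IsMonadicAdditive := by
  simp only [guards, List.forall_mem_append, List.forall_mem_cons, List.forall_mem_map]
  exact ⟨⟨isMonadicAdditive_unaryAtom trivial,
    isMonadicAdditive_unaryAtom ⟨trivial, t.noSubMul_toNum natVar⟩, List.forall_mem_nil _⟩,
    fun x _ => isMonadicAdditive_unaryAtom trivial⟩

theorem guards_eval_iff {t : NatTerm} {σ : Assignment} {I : Interpretation} :
    (∀ A ∈ t.guards, A.eval σ ∈ I.facts) ↔
      σ.num (powVar t) ∈ I.ext AuxPred.pow.name ∧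
      σ.num (powVar t) + (t.toNum natVar).eval σ ∈ I.ext AuxPred.exp.name ∧
      ∀ x ∈ t.vars, σ.num (natVar x) ∈ I.ext AuxPred.nat.name := by
  simp only [guards, List.forall_mem_append, List.forall_mem_cons, List.forall_mem_map,
    List.not_mem_nil, false_implies, implies_true, and_true, and_assoc, AuxPred.eval_atom_mem,
    NumTerm.eval]

end NatTerm

/-- The values of the variables of a `NatTerm` given by the numeric variables `natVar x`. -/
def Assignment.natVal (σ : Assignment) (x : ℕ) : ℕ := (σ.num (natVar x)).toNat

/-- The assignment under which `natVar x` has the value `v x` and `powVar t` the value `2 ^ t`. -/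
def Assignment.ofNat (v : ℕ → ℕ) : Assignment where
  obj := 0
  num n := match (decode n : Option (ℕ ⊕ NatTerm)) with
    | some (.inl x) => v x
    | some (.inr t) => 2 ^ t.eval v
    | none => 0

section OfNat

variable (v : ℕ → ℕ)

theorem ofNat_natVar (x : ℕ) : (Assignment.ofNat v).num (natVar x) = v x := by
  simp only [Assignment.ofNat, natVar, Encodable.encodek]

theorem ofNat_powVar (t : NatTerm) : (Assignment.ofNat v).num (powVar t) = 2 ^ t.eval v := by
  simp only [Assignment.ofNat, powVar, Encodable.encodek]

theorem eval_ofNat_toNum (t : NatTerm) : (t.toNum natVar).eval (Assignment.ofNat v) = t.eval v :=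
  NatTerm.eval_toNum fun x _ => ofNat_natVar v x

end OfNat

section Guards

variable {I : Interpretation} {t : NatTerm}

theorem natVal_eq_of_guards (hI : I.AuxSound) {σ : Assignment}
    (h : ∀ A ∈ t.guards, A.eval σ ∈ I.facts) :
    ∀ x ∈ t.vars, σ.num (natVar x) = σ.natVal x := by
  intro x hx
  obtain ⟨n, hn⟩ := hI .nat ((NatTerm.guards_eval_iff.1 h).2.2 x hx)
  simp only [Assignment.natVal, ← hn, Int.toNat_natCast]

theorem powVar_eq_of_guards (hI : I.AuxSound) {σ : Assignment}
    (h : ∀ A ∈ t.guards, A.eval σ ∈ I.facts) (hb : t.bound.Holds σ) :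
    σ.num (powVar t) = 2 ^ t.eval σ.natVal := by
  obtain ⟨hpow, hexp, -⟩ := NatTerm.guards_eval_iff.1 h
  simp only [NatTerm.bound, CompAtom.Holds, NumTerm.eval] at hb
  rw [NatTerm.eval_toNum (natVal_eq_of_guards hI h)] at hexp hb
  exact AuxPred.eq_two_pow_of_mem (hI .pow hpow) (hI .exp hexp) hb

theorem guards_ofNat (hI : I.AuxComplete) (t : NatTerm) (v : ℕ → ℕ) :
    ∀ A ∈ t.guards, A.eval (Assignment.ofNat v) ∈ I.facts := by
  rw [NatTerm.guards_eval_iff, ofNat_powVar, eval_ofNat_toNum]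
  exact ⟨hI .pow ⟨_, rfl⟩, hI .exp ⟨_, rfl⟩, fun x _ => ofNat_natVar v x ▸ hI .nat ⟨_, rfl⟩⟩

theorem bound_ofNat (t : NatTerm) (v : ℕ → ℕ) : t.bound.Holds (Assignment.ofNat v) := by
  simp only [NatTerm.bound, CompAtom.Holds, NumTerm.eval, eval_ofNat_toNum, ofNat_powVar]
  exact_mod_cast Nat.lt_two_pow_self

end Guards

section Translation

variable {κ : Type*} [Encodable κ]

/-- The name of the unary predicate representing the relation symbol `s`. The names below `3` are
those of the auxiliary predicates. -/
def relName (s : κ) : ℕ := encode s + 3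

theorem relName_injective : Function.Injective (relName : κ → ℕ) :=
  (add_left_injective 3).comp Encodable.encode_injective

theorem auxPred_name_ne_relName (X : AuxPred) (s : κ) : X.name ≠ relName s := by
  have : X.name < 3 := by cases X <;> decide
  grind [relName]

/-- The binary relation represented by the unary predicate `relName s`. -/
def Interpretation.rel (I : Interpretation) (s : κ) (a b : ℕ) : Prop :=
  (powPair a b : ℤ) ∈ I.ext (relName s)

namespace RelAtom

/-- The sum of the two arguments, the exponent used by `powPair`. -/
def sum {κ : Type*} (A : RelAtom κ) : NatTerm := A.fst + A.snd

/-- The translation of an atom; its argument has the value `powPair fst snd` once `powVar A.sum`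
has the value `2 ^ A.sum`. -/
def toStdAtom (A : RelAtom κ) : StdAtom :=
  unaryAtom (relName A.symbol) (.add (.var (powVar A.sum)) (A.fst.toNum natVar))

theorem isMonadicAdditive_toStdAtom (A : RelAtom κ) : A.toStdAtom.IsMonadicAdditive :=
  isMonadicAdditive_unaryAtom ⟨trivial, A.fst.noSubMul_toNum natVar⟩

theorem eval_toStdAtom_mem {A : RelAtom κ} {I : Interpretation} {σ : Assignment} {v : ℕ → ℕ}
    (hpow : σ.num (powVar A.sum) = 2 ^ A.sum.eval v)
    (hfst : (A.fst.toNum natVar).eval σ = A.fst.eval v) :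
    A.toStdAtom.eval σ ∈ I.facts ↔ A.Holds I.rel v := by
  rw [toStdAtom, eval_unaryAtom_mem, Holds, Interpretation.rel, powPair, NumTerm.eval, hfst,
    NumTerm.eval, hpow]
  simp only [sum, NatTerm.eval_add, Nat.cast_add, Nat.cast_pow, Nat.cast_ofNat]

theorem eval_ofNat_toStdAtom_mem {A : RelAtom κ} {I : Interpretation} {v : ℕ → ℕ} :
    A.toStdAtom.eval (.ofNat v) ∈ I.facts ↔ A.Holds I.rel v :=
  eval_toStdAtom_mem (ofNat_powVar v _) (eval_ofNat_toNum v _)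

theorem eval_toStdAtom_mem_of_guards {A : RelAtom κ} {I : Interpretation} (hI : I.AuxSound)
    {σ : Assignment} (h : ∀ B ∈ A.sum.guards, B.eval σ ∈ I.facts) (hb : A.sum.bound.Holds σ) :
    A.toStdAtom.eval σ ∈ I.facts ↔ A.Holds I.rel σ.natVal :=
  eval_toStdAtom_mem (powVar_eq_of_guards hI h hb) <|
    NatTerm.eval_toNum fun x hx => natVal_eq_of_guards hI h x (List.mem_append_left _ hx)

end RelAtom

namespace RelRule

/-- The head and the body atoms; the translation adds guards for each of them. -/
def atoms {κ : Type*} (r : RelRule κ) : List (RelAtom κ) := r.head :: r.body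

/-- The translation of a rule. -/
def toRule (r : RelRule κ) : Rule where
  sbody := r.atoms.flatMap (fun A => A.sum.guards) ++ r.body.map RelAtom.toStdAtom
  cbody := r.atoms.map fun A => A.sum.bound
  head := r.head.toStdAtom

theorem satisfiesRule_toRule {r : RelRule κ} {I : Interpretation} (hI : I.AuxSound)
    (h : r.Valid I.rel) : I.SatisfiesRule r.toRule := by
  intro σ hs hc
  simp only [toRule, List.forall_mem_append, List.forall_mem_flatMap, List.forall_mem_map] at hs hc
  have mem_iff (A) (hA : A ∈ r.atoms) : A.toStdAtom.eval σ ∈ I.facts ↔ A.Holds I.rel σ.natVal :=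
    A.eval_toStdAtom_mem_of_guards hI (hs.1 A hA) (hc A hA)
  refine (mem_iff r.head List.mem_cons_self).2 <| h _ fun A hA => ?_
  exact (mem_iff A (List.mem_cons_of_mem _ hA)).1 (hs.2 A hA)

theorem valid_of_satisfiesRule {r : RelRule κ} {I : Interpretation} (hI : I.AuxComplete)
    (h : I.SatisfiesRule r.toRule) : r.Valid I.rel := by
  intro v hv
  refine RelAtom.eval_ofNat_toStdAtom_mem.1 (h (.ofNat v) ?_ ?_)
  · simp only [toRule, List.forall_mem_append, List.forall_mem_flatMap, List.forall_mem_map]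
    exact ⟨fun A _ => guards_ofNat hI A.sum v,
      fun A hA => RelAtom.eval_ofNat_toStdAtom_mem.2 (hv A hA)⟩
  · simp only [toRule, List.forall_mem_map]
    exact fun A _ => bound_ofNat A.sum v

theorem isMonadicAdditive_toRule (r : RelRule κ) : r.toRule.IsMonadicAdditive where
  unary := by
    simp only [Rule.stdAtoms, toRule, List.forall_mem_cons, List.forall_mem_append,
      List.forall_mem_flatMap, List.forall_mem_map]
    exact ⟨r.head.isMonadicAdditive_toStdAtom, fun A _ => A.sum.isMonadicAdditive_guards,
      fun A _ => A.isMonadicAdditive_toStdAtom⟩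
  noSubMul := by
    simp only [toRule, List.forall_mem_map]
    exact fun A _ => ⟨A.sum.noSubMul_toNum natVar, trivial⟩
  safe := by
    have guarded {A : RelAtom κ} (hA : A ∈ r.atoms) {x : Var}
        (hx : x ∈ (NumTerm.add (.var (powVar A.sum)) (A.sum.toNum natVar)).vars) :
        ∃ B ∈ r.toRule.sbody, x ∈ B.vars :=
      ⟨_, List.mem_append_left _ (List.mem_flatMap.2 ⟨A, hA, List.mem_cons_of_mem _
        List.mem_cons_self⟩), mem_vars_unaryAtom.2 hx⟩
    rintro x (⟨A, hA, hx⟩ | ⟨C, hC, hx⟩)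
    · rcases List.mem_cons.1 hA with rfl | hA
      · exact guarded List.mem_cons_self <|
          (mem_vars_unaryAtom.1 hx).imp_right fun hx => Or.inl hx
      · exact ⟨A, hA, hx⟩
    · obtain ⟨A, hA, rfl⟩ := List.mem_map.1 hC
      exact guarded hA hx.symm

end RelRule

/-- The fact stating that `(a, b)` belongs to the relation `s`. -/
def relFact (s : κ) (a b : ℕ) : Fact := unaryFact (relName s) (powPair a b)

theorem primrec₂_relFact (s : κ) : Primrec₂ (relFact s) :=
  have natCast : Primrec fun n : ℕ => (n : ℤ) :=
    Primrec.encode_iff.1 (Primrec.nat_double.of_eq fun _ => rfl)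
  (primrec_unaryFact _).comp (natCast.comp primrec₂_powPair)

/-- The interpretation in which the auxiliary predicates have their intended extensions and the
relation symbols are interpreted by `G`. -/
def relInterpretation (G : κ → ℕ → ℕ → Prop) : Interpretation where
  facts := {f | (∃ X : AuxPred, ∃ z ∈ X.stdExt, f = unaryFact X.name z) ∨
    ∃ s a b, G s a b ∧ f = relFact s a b}
  wellSorted := by rintro _ (⟨X, z, -, rfl⟩ | ⟨s, a, b, -, rfl⟩) <;> rfl

section RelInterpretation

variable (G : κ → ℕ → ℕ → Prop)

theorem ext_relInterpretation (X : AuxPred) : (relInterpretation G).ext X.name = X.stdExt := by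
  ext z
  refine ⟨?_, fun hz => Or.inl ⟨X, z, hz, rfl⟩⟩
  rintro (⟨Y, w, hw, h⟩ | ⟨s, a, b, -, h⟩)
  · obtain ⟨hname, rfl⟩ := unaryFact_inj.1 h
    rwa [AuxPred.name_injective hname]
  · exact absurd (unaryFact_inj.1 h).1 (auxPred_name_ne_relName X s)

theorem rel_relInterpretation : (relInterpretation G).rel = G := by
  ext s a b
  refine ⟨?_, fun hG => Or.inr ⟨s, a, b, hG, rfl⟩⟩
  rintro (⟨X, z, -, h⟩ | ⟨t, c, d, hG, h⟩)
  · exact absurd (unaryFact_inj.1 h).1.symm (auxPred_name_ne_relName X s)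
  · obtain ⟨hname, hpair⟩ := unaryFact_inj.1 h
    obtain ⟨rfl, rfl⟩ := powPair_inj (Int.ofNat_inj.1 hpair)
    rwa [relName_injective hname]

theorem auxSound_relInterpretation : (relInterpretation G).AuxSound :=
  fun X => (ext_relInterpretation G X).subset

theorem auxComplete_relInterpretation : (relInterpretation G).AuxComplete :=
  fun X => (ext_relInterpretation G X).superset

end RelInterpretation

namespace RelProgram

/-- The translation of a system of rules over binary relations. -/
def toProgram (R : RelProgram κ) : Program := AuxPred.rules ++ R.map RelRule.toRule

theorem isMonadicAdditive_toProgram (R : RelProgram κ) : R.toProgram.IsMonadicAdditive :=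
  List.forall_mem_append.2 ⟨AuxPred.isMonadicAdditive_rules,
    List.forall_mem_map.2 fun r _ => r.isMonadicAdditive_toRule⟩

theorem entails_relFact_iff {R : RelProgram κ} {s : κ} {a b : ℕ} :
    R.toProgram.Entails (relFact s a b) ↔ R.Entails s a b := by
  simp only [Program.Entails, Interpretation.IsModel, toProgram, List.forall_mem_append,
    List.forall_mem_map]
  constructor
  · intro h G hG
    have hs := auxSound_relInterpretation G
    have hc := auxComplete_relInterpretation G
    rw [← rel_relInterpretation G] at hG ⊢
    exact h _ ⟨AuxPred.isModel_rules hs hc, fun r hr => r.satisfiesRule_toRule hs (hG r hr)⟩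
  · rintro h I ⟨haux, hI⟩
    exact h I.rel fun r hr =>
      r.valid_of_satisfiesRule (AuxPred.auxComplete_of_isModel haux) (hI r hr)

end RelProgram

end Translation

/-! ### Rules for partial recursive functions -/

open NatTerm (var)

section Pairing

variable {G : Code → ℕ → ℕ → Prop}

/-- In the interpretation `G` of the codes as binary relations, `k` is the pair of `a` and `b`. -/
def IsPair (G : Code → ℕ → ℕ → Prop) (k a b : ℕ) : Prop := G .left k a ∧ G .right k b

/-- Atoms stating that `k` is the pair of `a` and `b`. -/
def pairAtoms (k a b : NatTerm) : List (RelAtom Code) := [⟨.left, k, a⟩, ⟨.right, k, b⟩]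

theorem holds_pairAtoms_iff {v : ℕ → ℕ} {k a b : NatTerm} :
    (∀ A ∈ pairAtoms k a b, A.Holds G v) ↔ IsPair G (k.eval v) (a.eval v) (b.eval v) := by
  simp only [pairAtoms, holds_mk, IsPair, List.forall_mem_cons, List.not_mem_nil,
    false_implies, implies_true, and_true]

/-- Rules with the given body whose heads together state that `k` is the pair of `a` and `b`. -/
def pairRules (body : List (RelAtom Code)) (k a b : NatTerm) : RelProgram Code :=
  (pairAtoms k a b).map fun A => ⟨body, A⟩

theorem valid_pairRules_iff {body : List (RelAtom Code)} {k a b : NatTerm} :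
    (∀ r ∈ pairRules body k a b, r.Valid G) ↔ ∀ v, (∀ A ∈ body, A.Holds G v) →
      IsPair G (k.eval v) (a.eval v) (b.eval v) := by
  simp only [pairRules, List.forall_mem_map, RelRule.Valid, ← holds_pairAtoms_iff]
  exact ⟨fun h v hv A hA => h A hA v hv, fun h A hA v hv => h v hv A hA⟩

/-- Rules generating the graphs of the projections of `Nat.pair`. Successive pairs run along two
sides of a square, which yields one group of rules for each side and each turn. -/
def pairingRules : RelProgram Code :=
  pairRules [] 0 0 0 ++
    pairRules (pairAtoms (var 0) (var 1) (var 1 + var 2 + 1 + 1))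
      (var 0 + 1) (var 1 + 1) (var 1 + var 2 + 1 + 1) ++
    pairRules (pairAtoms (var 0) (var 1) (var 1 + 1)) (var 0 + 1) (var 1 + 1) 0 ++
    pairRules (pairAtoms (var 0) (var 1 + var 2 + 1) (var 1))
      (var 0 + 1) (var 1 + var 2 + 1) (var 1 + 1) ++
    pairRules (pairAtoms (var 0) (var 1) (var 1)) (var 0 + 1) 0 (var 1 + 1)

theorem valid_pairingRules_iff :
    (∀ r ∈ pairingRules, r.Valid G) ↔ IsPair G 0 0 0 ∧
      (∀ k a d, IsPair G k a (a + d + 1 + 1) → IsPair G (k + 1) (a + 1) (a + d + 1 + 1)) ∧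
      (∀ k a, IsPair G k a (a + 1) → IsPair G (k + 1) (a + 1) 0) ∧
      (∀ k a d, IsPair G k (a + d + 1) a → IsPair G (k + 1) (a + d + 1) (a + 1)) ∧
      ∀ k a, IsPair G k a a → IsPair G (k + 1) 0 (a + 1) := by
  simp only [pairingRules, List.forall_mem_append, valid_pairRules_iff, holds_pairAtoms_iff,
    List.not_mem_nil, false_implies, implies_true, forall_const, and_assoc,
    NatTerm.eval_zero, NatTerm.eval_one, NatTerm.eval_var, NatTerm.eval_add]
  let val (k a d : ℕ) : ℕ → ℕ := fun | 0 => k | 1 => a | _ => d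
  refine and_congr_right' <| and_congr ?_ <| and_congr ?_ <| and_congr ?_ ?_
  · exact ⟨fun h k a d => h (val k a d), fun h v => h _ _ _⟩
  · exact ⟨fun h k a => h (val k a 0), fun h v => h _ _⟩
  · exact ⟨fun h k a d => h (val k a d), fun h v => h _ _ _⟩
  · exact ⟨fun h k a => h (val k a 0), fun h v => h _ _⟩

end Pairing

theorem pair_succ_of_succ_lt {a b : ℕ} (h : a + 1 < b) :
    Nat.pair a b + 1 = Nat.pair (a + 1) b := by
  grind [Nat.pair]

theorem pair_self_succ_succ (a : ℕ) : Nat.pair a (a + 1) + 1 = Nat.pair (a + 1) 0 := by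
  grind [Nat.pair]

theorem pair_succ_of_lt {a b : ℕ} (h : b < a) : Nat.pair a b + 1 = Nat.pair a (b + 1) := by
  grind [Nat.pair]

theorem pair_self_succ (a : ℕ) : Nat.pair a a + 1 = Nat.pair 0 (a + 1) := by
  grind [Nat.pair]

/-- The intended interpretation of the codes as binary relations. -/
def graph (c : Code) (a b : ℕ) : Prop := b ∈ c.eval a

theorem isPair_graph_iff {k a b : ℕ} : IsPair graph k a b ↔ k = Nat.pair a b := by
  have mem_left : a ∈ Code.left.eval k ↔ a = k.unpair.1 := Part.mem_some_iff
  have mem_right : b ∈ Code.right.eval k ↔ b = k.unpair.2 := Part.mem_some_iff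
  rw [IsPair, graph, graph, mem_left, mem_right]
  constructor
  · rintro ⟨rfl, rfl⟩
    exact (Nat.pair_unpair k).symm
  · rintro rfl
    rw [Nat.unpair_pair]
    exact ⟨rfl, rfl⟩

theorem valid_pairingRules_graph : ∀ r ∈ pairingRules, r.Valid graph := by
  simp only [valid_pairingRules_iff, isPair_graph_iff]
  refine ⟨rfl, ?_, ?_, ?_, ?_⟩
  · rintro k a d rfl
    exact pair_succ_of_succ_lt (by lia)
  · rintro k a rfl
    exact pair_self_succ_succ a
  · rintro k a d rfl
    exact pair_succ_of_lt (by lia)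
  · rintro k a rfl
    exact pair_self_succ a

section Completeness

variable {G : Code → ℕ → ℕ → Prop}

theorem isPair_pair (h : ∀ r ∈ pairingRules, r.Valid G) (a b : ℕ) :
    IsPair G (Nat.pair a b) a b := by
  obtain ⟨zero, below, corner, above, diag⟩ := valid_pairingRules_iff.1 h
  suffices isPair_unpair : ∀ k, IsPair G k k.unpair.1 k.unpair.2 by
    simpa only [Nat.unpair_pair] using isPair_unpair (Nat.pair a b)
  intro k
  induction k with
  | zero => exact zero
  | succ k ih =>
    obtain ⟨a, b, rfl⟩ : ∃ a b, k = Nat.pair a b := ⟨_, _, (Nat.pair_unpair k).symm⟩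
    rw [Nat.unpair_pair] at ih
    rcases lt_trichotomy a b with hab | rfl | hab
    · rcases (Nat.succ_le_of_lt hab).eq_or_lt with rfl | hab
      · simpa only [pair_self_succ_succ, Nat.unpair_pair] using corner _ _ ih
      · obtain ⟨d, rfl⟩ : ∃ d, b = a + d + 1 + 1 := ⟨b - a - 2, by lia⟩
        simpa only [pair_succ_of_succ_lt hab, Nat.unpair_pair] using below _ _ _ ih
    · simpa only [pair_self_succ, Nat.unpair_pair] using diag _ _ ih
    · obtain ⟨d, rfl⟩ := Nat.exists_eq_add_of_lt hab
      simpa only [pair_succ_of_lt hab, Nat.unpair_pair] using above _ _ _ ih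

end Completeness

theorem mem_eval_pair {f g : Code} {n k : ℕ} :
    k ∈ (Code.pair f g).eval n ↔ ∃ a ∈ f.eval n, ∃ b ∈ g.eval n, k = Nat.pair a b := by
  simp [Code.eval, Seq.seq, eq_comm]

theorem mem_eval_comp {f g : Code} {n k : ℕ} :
    k ∈ (Code.comp f g).eval n ↔ ∃ a ∈ g.eval n, k ∈ f.eval a :=
  Part.mem_bind_iff

theorem mem_eval_prec_succ {f g : Code} {a n k : ℕ} :
    k ∈ (Code.prec f g).eval (Nat.pair a (n + 1)) ↔
      ∃ i ∈ (Code.prec f g).eval (Nat.pair a n), k ∈ g.eval (Nat.pair a (Nat.pair n i)) := by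
  rw [← Nat.succ_eq_add_one, Code.eval_prec_succ]
  exact Part.mem_bind_iff

theorem mem_eval_rfind' {f : Code} {a m k : ℕ} :
    k ∈ (Code.rfind' f).eval (Nat.pair a m) ↔ m ≤ k ∧ 0 ∈ f.eval (Nat.pair a k) ∧
      ∀ j, m ≤ j → j < k → ∃ w, w + 1 ∈ f.eval (Nat.pair a j) := by
  have mem_isZero {p : Part ℕ} : true ∈ p.map (fun n => decide (n = 0)) ↔ 0 ∈ p := by simp
  have mem_isSucc {p : Part ℕ} :
      false ∈ p.map (fun n => decide (n = 0)) ↔ ∃ w, w + 1 ∈ p := by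
    simp only [Part.mem_map_iff, decide_eq_false_iff_not]
    exact ⟨fun ⟨n, hn, hne⟩ => ⟨n - 1, by rwa [Nat.sub_one_add_one hne]⟩,
      fun ⟨w, hw⟩ => ⟨w + 1, hw, w.succ_ne_zero⟩⟩
  have mem_rfind {n : ℕ} :
      n ∈ Nat.rfind (fun n => (f.eval (Nat.pair a (n + m))).map fun i => decide (i = 0)) ↔
        0 ∈ f.eval (Nat.pair a (n + m)) ∧ ∀ j < n, ∃ w, w + 1 ∈ f.eval (Nat.pair a (j + m)) := by
    simp only [← mem_isZero, ← mem_isSucc]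
    exact Nat.mem_rfind
  simp only [Code.eval, Nat.unpaired, Nat.unpair_pair, Part.map_eq_map, Part.mem_map_iff,
    mem_rfind]
  constructor
  · rintro ⟨n, ⟨hzero, hsucc⟩, rfl⟩
    refine ⟨Nat.le_add_left m n, hzero, fun j hmj hj => ?_⟩
    simpa only [Nat.sub_add_cancel hmj] using hsucc (j - m) (by lia)
  · rintro ⟨hmk, hzero, hsucc⟩
    refine ⟨k - m, ⟨by rwa [Nat.sub_add_cancel hmk], fun j hj => ?_⟩, Nat.sub_add_cancel hmk⟩
    exact hsucc (j + m) (Nat.le_add_left m j) (by lia)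

section CodeRules

variable {G : Code → ℕ → ℕ → Prop} {f g : Code}

/-- The rule for the equation `pair f g n = (f n, g n)`. -/
def pairRule (f g : Code) : RelRule Code :=
  ⟨[⟨f, var 0, var 1⟩, ⟨g, var 0, var 2⟩] ++ pairAtoms (var 3) (var 1) (var 2),
    ⟨.pair f g, var 0, var 3⟩⟩

/-- The rule for the equation `comp f g n = f (g n)`. -/
def compRule (f g : Code) : RelRule Code :=
  ⟨[⟨g, var 0, var 1⟩, ⟨f, var 1, var 2⟩], ⟨.comp f g, var 0, var 2⟩⟩

/-- The rule for the equation `prec f g (a, 0) = f a`. -/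
def precZeroRule (f g : Code) : RelRule Code :=
  ⟨pairAtoms (var 0) (var 1) 0 ++ [⟨f, var 1, var 2⟩], ⟨.prec f g, var 0, var 2⟩⟩

/-- The rule for the equation `prec f g (a, n + 1) = g (a, (n, prec f g (a, n)))`. -/
def precSuccRule (f g : Code) : RelRule Code :=
  ⟨pairAtoms (var 0) (var 1) (var 2 + 1) ++ pairAtoms (var 3) (var 1) (var 2) ++
      [⟨.prec f g, var 3, var 4⟩] ++ pairAtoms (var 5) (var 2) (var 4) ++
      pairAtoms (var 6) (var 1) (var 5) ++ [⟨g, var 6, var 7⟩],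
    ⟨.prec f g, var 0, var 7⟩⟩

/-- The rule for the equation `rfind' f (a, m) = m` in the case `f (a, m) = 0`. -/
def rfindHitRule (f : Code) : RelRule Code :=
  ⟨pairAtoms (var 0) (var 1) (var 2) ++ [⟨f, var 0, 0⟩], ⟨.rfind' f, var 0, var 2⟩⟩

/-- The rule for the equation `rfind' f (a, m) = rfind' f (a, m + 1)` in the case
`f (a, m) ≠ 0`. -/
def rfindMissRule (f : Code) : RelRule Code :=
  ⟨pairAtoms (var 0) (var 1) (var 2) ++ [⟨f, var 0, var 3 + 1⟩] ++
      pairAtoms (var 4) (var 1) (var 2 + 1) ++ [⟨.rfind' f, var 4, var 5⟩],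
    ⟨.rfind' f, var 0, var 5⟩⟩

theorem valid_pairRule_iff : (pairRule f g).Valid G ↔
    ∀ n x y k, G f n x → G g n y → IsPair G k x y → G (.pair f g) n k := by
  simp only [pairRule, valid_mk_iff, List.forall_mem_append, List.forall_mem_cons,
    List.not_mem_nil, false_implies, implies_true, and_true, holds_pairAtoms_iff, holds_mk, and_imp,
    NatTerm.eval_var]
  exact ⟨fun h n x y k => h fun | 0 => n | 1 => x | 2 => y | _ => k, fun h v => h _ _ _ _⟩

theorem valid_compRule_iff : (compRule f g).Valid G ↔
    ∀ n x y, G g n x → G f x y → G (.comp f g) n y := by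
  simp only [compRule, valid_mk_iff, List.forall_mem_cons, List.not_mem_nil, false_implies,
    implies_true, holds_mk, and_true, and_imp, NatTerm.eval_var]
  exact ⟨fun h n x y => h fun | 0 => n | 1 => x | _ => y, fun h v => h _ _ _⟩

theorem valid_precZeroRule_iff : (precZeroRule f g).Valid G ↔
    ∀ k a b, IsPair G k a 0 → G f a b → G (.prec f g) k b := by
  simp only [precZeroRule, valid_mk_iff, List.forall_mem_append, List.forall_mem_singleton,
    holds_pairAtoms_iff, holds_mk, and_imp, NatTerm.eval_zero, NatTerm.eval_var]
  exact ⟨fun h k a b => h fun | 0 => k | 1 => a | _ => b, fun h v => h _ _ _⟩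

theorem valid_precSuccRule_iff : (precSuccRule f g).Valid G ↔
    ∀ k a n p i q r b, IsPair G k a (n + 1) → IsPair G p a n → G (.prec f g) p i →
      IsPair G q n i → IsPair G r a q → G g r b → G (.prec f g) k b := by
  simp only [precSuccRule, valid_mk_iff, List.forall_mem_append, List.forall_mem_singleton,
    holds_pairAtoms_iff, holds_mk, and_imp, NatTerm.eval_one, NatTerm.eval_var, NatTerm.eval_add]
  exact ⟨fun h k a n p i q r b => h fun
      | 0 => k | 1 => a | 2 => n | 3 => p | 4 => i | 5 => q | 6 => r | _ => b,
    fun h v => h _ _ _ _ _ _ _ _⟩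

theorem valid_rfindHitRule_iff : (rfindHitRule f).Valid G ↔
    ∀ k a m, IsPair G k a m → G f k 0 → G (.rfind' f) k m := by
  simp only [rfindHitRule, valid_mk_iff, List.forall_mem_append, List.forall_mem_singleton,
    holds_pairAtoms_iff, holds_mk, and_imp, NatTerm.eval_zero, NatTerm.eval_var]
  exact ⟨fun h k a m => h fun | 0 => k | 1 => a | _ => m, fun h v => h _ _ _⟩

theorem valid_rfindMissRule_iff : (rfindMissRule f).Valid G ↔
    ∀ k a m w l b, IsPair G k a m → G f k (w + 1) → IsPair G l a (m + 1) → G (.rfind' f) l b →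
      G (.rfind' f) k b := by
  simp only [rfindMissRule, valid_mk_iff, List.forall_mem_append, List.forall_mem_singleton,
    holds_pairAtoms_iff, holds_mk, and_imp, NatTerm.eval_one, NatTerm.eval_var, NatTerm.eval_add]
  exact ⟨fun h k a m w l b => h fun | 0 => k | 1 => a | 2 => m | 3 => w | 4 => l | _ => b,
    fun h v => h _ _ _ _ _ _⟩

end CodeRules

/-- Rules generating, together with `pairingRules`, the graph of the function with code `c`. -/
def codeRules : Code → RelProgram Code
  | .zero => [⟨[], ⟨.zero, var 0, 0⟩⟩]
  | .succ => [⟨[], ⟨.succ, var 0, var 0 + 1⟩⟩]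
  | .left => []
  | .right => []
  | .pair f g => codeRules f ++ codeRules g ++ [pairRule f g]
  | .comp f g => codeRules f ++ codeRules g ++ [compRule f g]
  | .prec f g => codeRules f ++ codeRules g ++ [precZeroRule f g, precSuccRule f g]
  | .rfind' f => codeRules f ++ [rfindHitRule f, rfindMissRule f]

section Graph

variable (f g : Code)

theorem valid_pairRule_graph : (pairRule f g).Valid graph := by
  simp only [valid_pairRule_iff, isPair_graph_iff]
  exact fun n x y k hx hy hk => mem_eval_pair.2 ⟨x, hx, y, hy, hk⟩

theorem valid_compRule_graph : (compRule f g).Valid graph :=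
  valid_compRule_iff.2 fun _ x _ hx hy => mem_eval_comp.2 ⟨x, hx, hy⟩

theorem valid_precZeroRule_graph : (precZeroRule f g).Valid graph := by
  simp only [valid_precZeroRule_iff, isPair_graph_iff]
  rintro _ a b rfl hb
  rwa [graph, Code.eval_prec_zero]

theorem valid_precSuccRule_graph : (precSuccRule f g).Valid graph := by
  simp only [valid_precSuccRule_iff, isPair_graph_iff]
  rintro _ a n _ i _ _ b rfl rfl hi rfl rfl hb
  exact mem_eval_prec_succ.2 ⟨i, hi, hb⟩

theorem valid_rfindHitRule_graph : (rfindHitRule f).Valid graph := by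
  simp only [valid_rfindHitRule_iff, isPair_graph_iff]
  rintro _ a m rfl hzero
  exact mem_eval_rfind'.2 ⟨le_rfl, hzero, fun j hmj hjm => absurd hjm hmj.not_gt⟩

theorem valid_rfindMissRule_graph : (rfindMissRule f).Valid graph := by
  simp only [valid_rfindMissRule_iff, isPair_graph_iff]
  rintro _ a m w _ b rfl hw rfl hb
  obtain ⟨hmb, hzero, hsucc⟩ := mem_eval_rfind'.1 hb
  refine mem_eval_rfind'.2 ⟨(Nat.lt_of_succ_le hmb).le, hzero, fun j hmj hjb => ?_⟩
  rcases hmj.eq_or_lt with rfl | hmj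
  · exact ⟨w, hw⟩
  · exact hsucc j hmj hjb

theorem valid_codeRules_graph (c : Code) : ∀ r ∈ codeRules c, r.Valid graph := by
  induction c <;> simp only [codeRules, List.forall_mem_append, List.forall_mem_cons,
    List.not_mem_nil, false_implies, implies_true, and_true]
  case zero => exact fun v _ => Part.mem_some _
  case succ => exact fun v _ => Part.mem_some _
  case pair f g hf hg => exact ⟨⟨hf, hg⟩, valid_pairRule_graph f g⟩
  case comp f g hf hg => exact ⟨⟨hf, hg⟩, valid_compRule_graph f g⟩
  case prec f g hf hg =>
    exact ⟨⟨hf, hg⟩, valid_precZeroRule_graph f g, valid_precSuccRule_graph f g⟩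
  case rfind' f hf => exact ⟨hf, valid_rfindHitRule_graph f, valid_rfindMissRule_graph f⟩

end Graph

section Completeness

variable {G : Code → ℕ → ℕ → Prop} {f g : Code}

theorem prec_complete (hpair : ∀ a b, IsPair G (Nat.pair a b) a b)
    (hzero : (precZeroRule f g).Valid G) (hsucc : (precSuccRule f g).Valid G)
    (hf : ∀ a b, graph f a b → G f a b) (hg : ∀ a b, graph g a b → G g a b) {a n b : ℕ}
    (h : graph (.prec f g) (Nat.pair a n) b) : G (.prec f g) (Nat.pair a n) b := by
  rw [valid_precZeroRule_iff] at hzero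
  rw [valid_precSuccRule_iff] at hsucc
  induction n generalizing b with
  | zero =>
    rw [graph, Code.eval_prec_zero] at h
    exact hzero _ a b (hpair _ _) (hf a b h)
  | succ n ih =>
    obtain ⟨i, hi, hb⟩ := mem_eval_prec_succ.1 h
    exact hsucc _ a n _ i _ _ b (hpair _ _) (hpair _ _) (ih hi) (hpair _ _) (hpair _ _) (hg _ _ hb)

theorem rfind'_complete (hpair : ∀ a b, IsPair G (Nat.pair a b) a b)
    (hhit : (rfindHitRule f).Valid G) (hmiss : (rfindMissRule f).Valid G)
    (hf : ∀ a b, graph f a b → G f a b) {a m b : ℕ}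
    (h : graph (.rfind' f) (Nat.pair a m) b) : G (.rfind' f) (Nat.pair a m) b := by
  rw [valid_rfindHitRule_iff] at hhit
  rw [valid_rfindMissRule_iff] at hmiss
  obtain ⟨hmb, hzero, hsucc⟩ := mem_eval_rfind'.1 h
  refine Nat.decreasingInduction' (P := fun j => G (.rfind' f) (Nat.pair a j) b)
    (fun j hjb hmj ih => ?_) hmb (hhit _ a b (hpair _ _) (hf _ _ hzero))
  obtain ⟨w, hw⟩ := hsucc j hmj hjb
  exact hmiss _ a j w _ b (hpair _ _) (hf _ _ hw) (hpair _ _) ih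

theorem codeRules_complete (hpair : ∀ a b, IsPair G (Nat.pair a b) a b) {c : Code}
    (hc : ∀ r ∈ codeRules c, r.Valid G) (a b : ℕ) (h : graph c a b) : G c a b := by
  induction c generalizing a b <;> simp only [codeRules, List.forall_mem_append,
    List.forall_mem_cons, List.not_mem_nil, false_implies, implies_true, and_true] at hc
  case zero =>
    obtain rfl : b = 0 := Part.mem_some_iff.1 h
    exact hc (fun _ => a) (List.forall_mem_nil _)
  case succ =>
    obtain rfl : b = a + 1 := Part.mem_some_iff.1 h
    exact hc (fun _ => a) (List.forall_mem_nil _)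
  case left =>
    obtain rfl : b = a.unpair.1 := Part.mem_some_iff.1 h
    simpa only [Nat.pair_unpair] using (hpair a.unpair.1 a.unpair.2).1
  case right =>
    obtain rfl : b = a.unpair.2 := Part.mem_some_iff.1 h
    simpa only [Nat.pair_unpair] using (hpair a.unpair.1 a.unpair.2).2
  case pair f g hf hg =>
    obtain ⟨x, hx, y, hy, rfl⟩ := mem_eval_pair.1 h
    exact valid_pairRule_iff.1 hc.2 a x y _ (hf hc.1.1 _ _ hx) (hg hc.1.2 _ _ hy) (hpair x y)
  case comp f g hf hg =>
    obtain ⟨x, hx, hb⟩ := mem_eval_comp.1 h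
    exact valid_compRule_iff.1 hc.2 a x b (hg hc.1.2 _ _ hx) (hf hc.1.1 _ _ hb)
  case prec f g hf hg =>
    rw [← Nat.pair_unpair a] at h ⊢
    exact prec_complete hpair hc.2.1 hc.2.2 (hf hc.1.1) (hg hc.1.2) h
  case rfind' f hf =>
    rw [← Nat.pair_unpair a] at h ⊢
    exact rfind'_complete hpair hc.2.1 hc.2.2 (hf hc.1) h

end Completeness

theorem entails_code_iff {c : Code} {a b : ℕ} :
    RelProgram.Entails (pairingRules ++ codeRules c) c a b ↔ b ∈ c.eval a := by
  simp only [RelProgram.Entails, List.forall_mem_append, and_imp]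
  exact ⟨fun h => h graph valid_pairingRules_graph (valid_codeRules_graph c),
    fun h G hpair hc => codeRules_complete (isPair_pair hpair) hc a b h⟩

/-! ### Undecidability -/

theorem exists_code_zero_mem_eval_iff {α : Type*} [Primcodable α] {p : α → Prop} (hp : REPred p) :
    ∃ c : Code, ∀ a, 0 ∈ c.eval (encode a) ↔ p a := by
  obtain ⟨c, hc⟩ := Code.exists_code.1 hp
  refine ⟨c, fun a => ?_⟩
  have eval_encode : c.eval (encode a) = (Part.assert (p a) fun _ => Part.some ()).map encode := by
    simp only [hc, Encodable.encodek, Part.coe_some, Part.bind_some]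
  simp only [eval_encode, Part.mem_map_iff, Part.mem_assert_iff, Part.mem_some_iff]
  exact ⟨fun ⟨_, ⟨ha, _⟩, _⟩ => ha, fun ha => ⟨(), ⟨ha, trivial⟩, rfl⟩⟩

theorem exists_program_entails_iff {α : Type*} [Primcodable α] {p : α → Prop} (hp : REPred p) :
    ∃ P : Program, P.IsMonadicAdditive ∧ ∃ f : α → Fact, Computable f ∧
      (∀ a, (f a).WellSorted) ∧ ∀ a, P.Entails (f a) ↔ p a := by
  obtain ⟨c, hc⟩ := exists_code_zero_mem_eval_iff hp
  refine ⟨RelProgram.toProgram (pairingRules ++ codeRules c),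
    RelProgram.isMonadicAdditive_toProgram _, fun a => relFact c (encode a) 0,
    ((primrec₂_relFact c).comp .encode (.const 0)).to_comp, fun a => wellSorted_unaryFact _ _,
    fun a => ?_⟩
  rw [RelProgram.entails_relFact_iff, entails_code_iff, hc]

end DatalogZ

open DatalogZ in
theorem mainTheorem7_general :
    ∃ P : Program, P.WellFormed ∧ P.NoSubMul ∧ P.AtMostOneNumericTerm ∧
      ¬ ∃ D : Fact → Prop, ComputablePred D ∧ ∀ α, α.WellSorted → (D α ↔ P.Entails α) := by
  obtain ⟨P, hP, f, hf, hsorted, hentails⟩ :=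
    exists_program_entails_iff (ComputablePred.halting_problem_re 0)
  refine ⟨P, hP.wellFormed, hP.noSubMul, hP.atMostOneNumericTerm, ?_⟩
  rintro ⟨D, hD, hDP⟩
  refine ComputablePred.halting_problem 0 ?_
  exact ComputablePred.computable_of_manyOneReducible
    ⟨f, hf, fun c => (hentails c).symm.trans (hDP _ (hsorted c)).symm⟩ hD

/-- There is no algorithm that decides `P ⊨ α` correctly for all facts `α` and all programs `P`
without `×` and `-` in which each standard atom has at most one numeric term. -/
theorem mainTheorem7 :
    ¬ ∃ D : DatalogZ.Program × DatalogZ.Fact → Prop, ComputablePred D ∧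
      ∀ (P : DatalogZ.Program) (α : DatalogZ.Fact),
        P.WellFormed → P.NoSubMul → P.AtMostOneNumericTerm → α.WellSorted →
          (D (P, α) ↔ P.Entails α) := by
  rintro ⟨D, hD, hDP⟩
  obtain ⟨P, hwf, hns, hone, hP⟩ := mainTheorem7_general
  have pair_P : Computable fun α : DatalogZ.Fact => (P, α) := (Computable.const P).pair .id
  exact hP ⟨fun α => D (P, α), ComputablePred.computable_of_manyOneReducible
    ⟨_, pair_P, fun α => Iff.rfl⟩ hD, fun α => hDP P α hwf hns hone⟩
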